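/- Fix $\alpha\in(0,1)$, $K>0$ and $\sigma_{\mathrm{known}}>0$. Let $\Theta$ be the set of pairs $\theta=(\theta_1,P)$ with $\theta_1\in\mathbb R$ and $P$ a probability distribution on $\mathbb R$ such that $\int x\,dP=0$ and $0<\int x^2\,dP<\infty$. For $\theta\in\Theta$ let $P_\theta$ be the law of $\xi=\theta_1+V$ with $V\sim P$, let $\mathbb P_\theta$ be the law of an i.i.d. sample $\xi_1,\dots,\xi_n$ from $P_\theta$, and put $\bar\xi_n=n^{-1}\sum_{i=1}^n\xi_i$, $\sigma(\theta)^2=\mathbb V_\theta(\xi)$, $\lambda_3(\theta)=\mathbb E_\theta[(\xi-\theta_1)^3]/\sigma(\theta)^3$, $K_4(\theta)=\mathbb E_\theta[(\xi-\theta_1)^4]/\sigma(\theta)^4\in[0,\infty]$, and $S_n=\sum_{i=1}^n(\xi_i-\theta_1)/(\sigma(\theta)\sqrt n)$. Let $$\Theta_{\mathrm{EE}}=\{\theta\in\Theta: K_4(\theta)\le K\},\qquad \Theta^{\mathrm{known}}=\{\theta\in\Theta:\mathbb V_\theta(\xi)=\sigma_{\mathrm{known}}^2\},\qquad \Theta_{\mathrm{EE}}^{\mathrm{known}}=\Theta_{\mathrm{EE}}\cap\Theta^{\mathrm{known}}.$$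 Let $\Phi$, $\varphi$ and $q_{\mathcal N(0,1)}$ be the c.d.f., density and quantile function of the standard normal distribution, and for $\theta\in\Theta_{\mathrm{EE}}$ and $n\ge1$ set $$\Delta_{n,\mathrm B}(\theta)=\sup_{x\in\mathbb R}\bigl|\mathbb P_\theta(S_n\le x)-\Phi(x)\bigr|,\qquad \Delta_{n,\mathrm E}(\theta)=\sup_{x\in\mathbb R}\Bigl|\mathbb P_\theta(S_n\le x)-\Phi(x)-\frac{\lambda_3(\theta)}{6\sqrt n}(1-x^2)\varphi(x)\Bigr|.$$ Let $(\delta_n)_{n\ge1}$ be a sequence of real numbers such that $\delta_n\ge\sup_{\theta\in\Theta_{\mathrm{EE}}}\min\{\Delta_{n,\mathrm E}(\theta),\Delta_{n,\mathrm B}(\theta)\}$ for every $n\ge1$ and $\delta_n\to0$. Define the confidence interval $$\mathrm{CI}_n=\begin{cases}\Bigl[\bar\xi_n-\frac{\sigma_{\mathrm{known}}}{\sqrt n}\,q_{\mathcal N(0,1)}\bigl(1-\frac\alpha2+\delta_n\bigr),\ \bar\xi_n+\frac{\sigma_{\mathrm{known}}}{\sqrt n}\,q_{\mathcal N(0,1)}\bigl(1-\frac\alpha2+\delta_n\bigr)\Bigr]&\text{if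 }\delta_n<\alpha/2,\\ \mathbb R&\text{otherwise.}\end{cases}$$ Then: (i) $\mathrm{CI}_n$ is asymptotically exact pointwise over $\Theta^{\mathrm{known}}$ at level $1-\alpha$: for every $\theta\in\Theta^{\mathrm{known}}$, $\lim_{n\to\infty}\mathbb P_\theta(\theta_1\in\mathrm{CI}_n)=1-\alpha$; (ii) $\mathrm{CI}_n$ is asymptotically exact uniformly over $\Theta_{\mathrm{EE}}^{\mathrm{known}}$ at level $1-\alpha$: $$\lim_{n\to\infty}\ \sup_{\theta\in\Theta_{\mathrm{EE}}^{\mathrm{known}}}\bigl|\mathbb P_\theta(\theta_1\in\mathrm{CI}_n)-(1-\alpha)\bigr|=0,$$ where the supremum over an empty class is $0$. -/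

import Mathlib

open MeasureTheory ProbabilityTheory Filter Topology

noncomputable section

namespace MeanCI

/-! ### Confidence sets and their quality measures -/

/-- A (family in the sample size `n` of) confidence set(s) at a fixed nominal level: a map from
samples of size `n` to Borel subsets of `ℝ`, such that all coverage events are measurable. -/
structure ConfidenceSet (X : Type*) [MeasurableSpace X] where
  /-- the confidence set computed from the sample -/
  set : (n : ℕ) → (Fin n → X) → Set ℝ
  measurableSet_set : ∀ n x, MeasurableSet (set n x)
  measurableSet_covers : ∀ n (t : ℝ), MeasurableSet {x | t ∈ set n x}

section Quality

variable {X : Type*} [MeasurableSpace X] {ι : Type*}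

/-- Coverage probability: the probability, for an i.i.d. sample of size `n` from `P θ`, that the
confidence set contains the target `T θ`. -/
def coverage (P : ι → Measure X) (T : ι → ℝ) (CS : ConfidenceSet X) (n : ℕ) (θ : ι) : ℝ :=
  (Measure.pi fun _ : Fin n => P θ).real {x | T θ ∈ CS.set n x}

/-- Asymptotic exactness at level `1 - α`, pointwise over `Θ`. -/
def AsympExactPointwise (P : ι → Measure X) (T : ι → ℝ) (Θ : Set ι) (CS : ConfidenceSet X)
    (α : ℝ) : Prop :=
  ∀ θ ∈ Θ, Tendsto (fun n : ℕ => coverage P T CS n θ) atTop (𝓝 (1 - α))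

/-- Asymptotic exactness at level `1 - α`, uniformly over `Θ`. (The supremum is that of a family
with values in `[0, max α (1 - α)]`; it is `0` if `Θ` is empty.) -/
def AsympExactUniformly (P : ι → Measure X) (T : ι → ℝ) (Θ : Set ι) (CS : ConfidenceSet X)
    (α : ℝ) : Prop :=
  Tendsto (fun n : ℕ => ⨆ θ : Θ, |coverage P T CS n θ - (1 - α)|) atTop (𝓝 0)

end Quality

/-! ### The model: real distributions with finite non-zero variance -/

/-- A parameter `(θ₁, P)`: an expectation, and the distribution of the centered variable. -/
abbrev Param : Type := ℝ × ProbabilityMeasure ℝ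

/-- The parameter set `Θ`: `P` is centered with finite non-zero second moment. -/
def Theta : Set Param :=
  {θ | MemLp id 2 (θ.2 : Measure ℝ) ∧ ∫ x, x ∂(θ.2 : Measure ℝ) = 0 ∧
    0 < ∫ x, x ^ 2 ∂(θ.2 : Measure ℝ)}

/-- The law of one observation `ξ = θ₁ + V`, with `V ∼ P`. -/
def law (θ : Param) : Measure ℝ := (θ.2 : Measure ℝ).map (fun v => θ.1 + v)

instance (θ : Param) : IsProbabilityMeasure (law θ) :=
  Measure.isProbabilityMeasure_map (by fun_prop)

/-- The target `T(θ₁, P) = θ₁`. -/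
def target (θ : Param) : ℝ := θ.1

/-- The expectation of `ξ`. -/
def mean (θ : Param) : ℝ := ∫ x, x ∂(law θ)

/-- The standard deviation of `ξ`. -/
def sigma (θ : Param) : ℝ := √(Var[id; law θ])

/-- The skewness of `ξ` (used only where the fourth moment is finite). -/
def lambda3 (θ : Param) : ℝ := ∫ x, (x - mean θ) ^ 3 / sigma θ ^ 3 ∂(law θ)

/-- The kurtosis of `ξ`, possibly infinite. -/
def K4 (θ : Param) : ENNReal := ∫⁻ x, ENNReal.ofReal ((x - mean θ) ^ 4 / sigma θ ^ 4) ∂(law θ)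

/-- Bounded-kurtosis class. -/
def ThetaEE (K : ℝ) : Set Param := {θ ∈ Theta | K4 θ ≤ ENNReal.ofReal K}

/-- Known-variance class. -/
def ThetaKnown (σ : ℝ) : Set Param := {θ ∈ Theta | Var[id; law θ] = σ ^ 2}

/-- Bounded-kurtosis known-variance class. -/
def ThetaEEKnown (K σ : ℝ) : Set Param := {θ ∈ ThetaEE K | Var[id; law θ] = σ ^ 2}

/-! ### Distances to normality -/

/-- The c.d.f. at `x` of the standardized sum `Sₙ` of `n` i.i.d. observations. -/
def cdfSum (n : ℕ) (θ : Param) (x : ℝ) : ℝ :=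
  (Measure.pi fun _ : Fin n => law θ).real
    {ξ | (∑ i, (ξ i - mean θ)) / (sigma θ * √(n : ℝ)) ≤ x}

/-- The standard normal c.d.f. -/
def Phi (x : ℝ) : ℝ := cdf (gaussianReal 0 1) x

/-- The standard normal density. -/
def phi (x : ℝ) : ℝ := gaussianPDFReal 0 1 x

/-- Uniform distance to the normal c.d.f. (Berry–Esseen). -/
def DeltaB (n : ℕ) (θ : Param) : ℝ := ⨆ x : ℝ, |cdfSum n θ x - Phi x|

/-- Uniform distance to the first-order Edgeworth expansion. -/
def DeltaE (n : ℕ) (θ : Param) : ℝ :=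
  ⨆ x : ℝ, |cdfSum n θ x - Phi x - lambda3 θ / (6 * √(n : ℝ)) * (1 - x ^ 2) * phi x|

/-! ### The known-variance confidence interval -/

/-- The standard normal quantile at order `τ ∈ (0, 1)`. -/
def gaussQuantile (τ : ℝ) : ℝ := sInf {x | τ ≤ Phi x}

/-- The empirical mean. -/
def sampleMean {n : ℕ} (ξ : Fin n → ℝ) : ℝ := (∑ i, ξ i) / n

/-- The half-width of the known-variance interval, when it is not the whole line. -/
def halfWidth (σ α : ℝ) (δ : ℕ → ℝ) (n : ℕ) : ℝ :=
  σ / √(n : ℝ) * gaussQuantile (1 - α / 2 + δ n)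

open Classical in
/-- The confidence interval with known standard deviation `σ`, at nominal level `1 - α`. -/
def ciKnown (σ α : ℝ) (δ : ℕ → ℝ) : ConfidenceSet ℝ where
  set n ξ := if δ n < α / 2 then
      Set.Icc (sampleMean ξ - halfWidth σ α δ n) (sampleMean ξ + halfWidth σ α δ n)
    else Set.univ
  measurableSet_set n ξ := by
    split_ifs
    · exact measurableSet_Icc
    · exact MeasurableSet.univ
  measurableSet_covers n t := by
    split_ifs
    · have h : Measurable fun ξ : Fin n → ℝ => sampleMean ξ := by
        unfold sampleMean; fun_prop
      exact (measurableSet_le (h.sub_const _) measurable_const).inter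
        (measurableSet_le measurable_const (h.add_const _))
    · simp

end MeanCI

end

namespace MeanCI

/-! ### The standard normal distribution -/

/-! Once `δ n < α / 2` and `1 ≤ n`, the interval covers `θ₁` exactly when `|Sₙ| ≤ qₙ`, with `qₙ` the
normal quantile of order `1 - α / 2 + δ n` (`coverage_ciKnown`). Pointwise, the CLT gives the limit
of `P(|Sₙ| ≤ a)` for fixed `a` (`tendsto_absSumProb`), and monotonicity in `a` handles the moving
`qₙ`. Uniformly, `P(|Sₙ| ≤ a) = F(a) - F(-a⁻)` for the c.d.f. `F` of `Sₙ`. The Edgeworth correction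
is even, so it cancels in this difference, and `DeltaE` controls the error of the plain normal
approximation just as `DeltaB` does (`abs_absSumProb_sub_le_min`). The error is thus at most `2 δ
n`. Since `2 Φ(qₙ) - 1 = 1 - α + 2 δ n`, the coverage is within `4 |δ n|` of `1 - α`. -/

lemma Phi_eq_real (x : ℝ) : Phi x = (gaussianReal 0 1).real (Set.Iic x) := cdf_eq_real _ x

lemma continuous_Phi : Continuous Phi := by
  rw [continuous_iff_continuousAt]
  intro x
  have : NullSingletonClass (gaussianReal 0 1) := nullSingletonClass_gaussianReal one_ne_zero
  have h : (cdf (gaussianReal 0 1)).measure {x} = 0 := by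
    rw [measure_cdf]; exact measure_singleton x
  rw [StieltjesFunction.measure_singleton, ENNReal.ofReal_eq_zero, sub_nonpos] at h
  have hm := monotone_cdf (gaussianReal 0 1)
  refine hm.continuousAt_iff_leftLim_eq_rightLim.2 (le_antisymm (hm.leftLim_le_rightLim le_rfl) ?_)
  rwa [StieltjesFunction.rightLim_eq]

lemma monotone_Phi : Monotone Phi := monotone_cdf _

lemma Phi_mem_Icc (x : ℝ) : Phi x ∈ Set.Icc (0 : ℝ) 1 := ⟨cdf_nonneg _ x, cdf_le_one _ x⟩

lemma Phi_neg (x : ℝ) : Phi (-x) = 1 - Phi x := by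
  have : NullSingletonClass (gaussianReal 0 1) := nullSingletonClass_gaussianReal one_ne_zero
  rw [Phi_eq_real, Phi_eq_real, ← probReal_compl_eq_one_sub measurableSet_Iic, Set.compl_Iic]
  have h : (gaussianReal 0 1).map (fun x => -x) = gaussianReal 0 1 := by
    rw [gaussianReal_map_neg, neg_zero]
  conv_lhs => rw [← h]
  rw [map_measureReal_apply measurable_neg measurableSet_Iic]
  have : (fun x : ℝ => -x) ⁻¹' Set.Iic (-x) = Set.Ici x := by ext; simp
  rw [this, measureReal_def, measureReal_def, measure_congr Ioi_ae_eq_Ici]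

lemma gaussianReal_real_Icc_neg_self {a : ℝ} (ha : 0 ≤ a) :
    (gaussianReal 0 1).real (Set.Icc (-a) a) = 2 * Phi a - 1 := by
  have : NullSingletonClass (gaussianReal 0 1) := nullSingletonClass_gaussianReal one_ne_zero
  have h : (gaussianReal 0 1).real (Set.Icc (-a) a) = Phi a - Phi (-a) := by
    rw [Phi_eq_real, Phi_eq_real, ← measureReal_sdiff (Set.Iic_subset_Iic.2 (by linarith))
      measurableSet_Iic, Set.Iic_sdiff_Iic, measureReal_def, measureReal_def,
      measure_congr Ioc_ae_eq_Icc]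
  rw [h, Phi_neg]; ring

lemma Phi_gaussQuantile {τ : ℝ} (h0 : 0 < τ) (h1 : τ < 1) : Phi (gaussQuantile τ) = τ := by
  have hne : {x | τ ≤ Phi x}.Nonempty :=
    ((tendsto_cdf_atTop (gaussianReal 0 1)).eventually_const_le h1).exists
  have hbdd : BddBelow {x | τ ≤ Phi x} := by
    obtain ⟨b, hb⟩ := ((tendsto_cdf_atBot (gaussianReal 0 1)).eventually_lt_const h0).exists
    refine ⟨b, fun x hx => ?_⟩
    by_contra! hxb
    exact absurd (hx.trans (monotone_Phi hxb.le)) (not_le.2 hb)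
  have hcl : IsClosed {x | τ ≤ Phi x} := isClosed_le continuous_const continuous_Phi
  refine le_antisymm ?_ (hcl.csInf_mem hne hbdd)
  refine le_of_tendsto (continuous_Phi.continuousWithinAt (s := Set.Iio (gaussQuantile τ))) ?_
  filter_upwards [self_mem_nhdsWithin] with x hx
  by_contra! h
  exact absurd (csInf_le hbdd (show x ∈ {x | τ ≤ Phi x} from h.le)) (not_le.2 hx)

lemma gaussQuantile_lt {τ τ' : ℝ} (h0 : 0 < τ) (h1 : τ' < 1) (h : τ < τ') :
    gaussQuantile τ < gaussQuantile τ' := by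
  by_contra! hle
  have := monotone_Phi hle
  rw [Phi_gaussQuantile h0 (h.trans h1), Phi_gaussQuantile (h0.trans h) h1] at this
  linarith

lemma gaussQuantile_nonneg {τ : ℝ} (h0 : 1 / 2 < τ) (h1 : τ < 1) : 0 ≤ gaussQuantile τ := by
  by_contra! hlt
  have h := monotone_Phi hlt.le
  have h2 := Phi_neg 0
  rw [Phi_gaussQuantile (by linarith) h1] at h
  rw [neg_zero] at h2
  linarith

/-- Makes the family under the supremum in `DeltaE` bounded; an unbounded real supremum would
default to `0`. The bound comes from `1 + y ≤ exp y` at `y = x ^ 2 / 2`. -/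
lemma exists_bound_one_sub_sq_mul_phi : ∃ C, ∀ x : ℝ, |(1 - x ^ 2) * phi x| ≤ C := by
  refine ⟨(√(2 * Real.pi))⁻¹ * 2, fun x => ?_⟩
  have h1 : phi x = (√(2 * Real.pi))⁻¹ * Real.exp (-(x ^ 2 / 2)) := by
    simp [phi, gaussianPDFReal, neg_div]
  have h2 : (x ^ 2 / 2 + 1) * Real.exp (-(x ^ 2 / 2)) ≤ 1 := by
    rw [Real.exp_neg, ← div_eq_mul_inv, div_le_one (Real.exp_pos _)]
    exact Real.add_one_le_exp _
  have h3 : |1 - x ^ 2| ≤ 2 * (x ^ 2 / 2 + 1) := by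
    rw [abs_le]; constructor <;> nlinarith [sq_nonneg x]
  have he := Real.exp_pos (-(x ^ 2 / 2))
  rw [h1, abs_mul, abs_of_nonneg (a := _ * Real.exp _) (by positivity), mul_left_comm]
  gcongr
  nlinarith [mul_le_mul_of_nonneg_right h3 he.le]

/-! ### The standardized sum and the coverage event -/

/-- The standardized sum `Sₙ`. -/
noncomputable def stdSum (n : ℕ) (θ : Param) (ξ : Fin n → ℝ) : ℝ :=
  (∑ i, (ξ i - mean θ)) / (sigma θ * √(n : ℝ))

lemma measurable_stdSum (n : ℕ) (θ : Param) : Measurable (stdSum n θ) := by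
  unfold stdSum; fun_prop

/-- The probability that `|Sₙ| ≤ a`. -/
noncomputable def absSumProb (n : ℕ) (θ : Param) (a : ℝ) : ℝ :=
  (Measure.pi fun _ : Fin n => law θ).real {ξ | stdSum n θ ξ ∈ Set.Icc (-a) a}

lemma absSumProb_mono (n : ℕ) (θ : Param) : Monotone (absSumProb n θ) := fun _ _ h =>
  measureReal_mono fun _ hξ => Set.Icc_subset_Icc (neg_le_neg h) h hξ

lemma memLp_law {θ : Param} (hθ : θ ∈ Theta) : MemLp id 2 (law θ) := by
  rw [law, memLp_map_measure_iff (by fun_prop) (by fun_prop)]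
  exact (memLp_const θ.1).add hθ.1

lemma mean_eq {θ : Param} (hθ : θ ∈ Theta) : mean θ = θ.1 := by
  have hi : Integrable (fun x : ℝ => x) (θ.2 : Measure ℝ) := hθ.1.integrable one_le_two
  rw [mean, law, integral_map (by fun_prop) (by fun_prop), integral_add (by fun_prop) hi, hθ.2.1]
  simp

lemma sigma_eq {σ : ℝ} (hσ : 0 < σ) {θ : Param} (h : Var[id; law θ] = σ ^ 2) : sigma θ = σ := by
  rw [sigma, h, Real.sqrt_sq hσ.le]

lemma coverage_ciKnown {σ α : ℝ} (hσ : 0 < σ) {δ : ℕ → ℝ} {θ : Param} (hθ : θ ∈ ThetaKnown σ)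
    {n : ℕ} (hn : 1 ≤ n) (hδ : δ n < α / 2) :
    coverage law target (ciKnown σ α δ) n θ
      = absSumProb n θ (gaussQuantile (1 - α / 2 + δ n)) := by
  have hn0 : (0 : ℝ) < n := by exact_mod_cast hn
  have hs : 0 < √(n : ℝ) := Real.sqrt_pos.2 hn0
  have hs2 : √(n : ℝ) * √(n : ℝ) = n := Real.mul_self_sqrt hn0.le
  unfold coverage absSumProb
  congr 1
  ext ξ
  set q := gaussQuantile (1 - α / 2 + δ n) with hq
  have key : sampleMean ξ = θ.1 + σ / √(n : ℝ) * stdSum n θ ξ := by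
    rw [stdSum, sigma_eq hσ hθ.2, mean_eq hθ.1, sampleMean, Finset.sum_sub_distrib]
    simp only [Finset.sum_const, Finset.card_univ, Fintype.card_fin, nsmul_eq_mul]
    have : σ / √(n : ℝ) * ((∑ i, ξ i - n * θ.1) / (σ * √(n : ℝ)))
        = (∑ i, ξ i - n * θ.1) / n := by
      rw [div_mul_div_comm, mul_left_comm, hs2, mul_div_mul_left _ _ hσ.ne']
    rw [this]; field_simp; ring
  have hc : 0 < σ / √(n : ℝ) := div_pos hσ hs
  simp only [ciKnown, if_pos hδ, target, halfWidth, Set.mem_ofPred_eq, Set.mem_Icc, ← hq, key]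
  constructor
  · rintro ⟨h1, h2⟩
    exact ⟨le_of_mul_le_mul_left (by linarith) hc, le_of_mul_le_mul_left (by linarith) hc⟩
  · rintro ⟨h1, h2⟩
    have h1' := mul_le_mul_of_nonneg_left h1 hc.le
    have h2' := mul_le_mul_of_nonneg_left h2 hc.le
    constructor <;> linarith

/-! ### Pointwise convergence -/

/-- The CLT concerns one infinite i.i.d. sequence, whereas coverage uses a separate product space
for each `n`; this transfers between them. -/
lemma map_infinitePi_fin (μ : Measure ℝ) [IsProbabilityMeasure μ] (n : ℕ) :
    (Measure.infinitePi fun _ : ℕ => μ).map (fun ω (i : Fin n) => ω i)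
      = Measure.pi fun _ : Fin n => μ := by
  have h : iIndepFun (fun (i : ℕ) (ω : ℕ → ℝ) => ω i) (Measure.infinitePi fun _ : ℕ => μ) :=
    iIndepFun_infinitePi (X := fun _ x => x) (by fun_prop)
  have h2 := (iIndepFun_iff_map_fun_eq_pi_map
    (f := fun (i : Fin n) (ω : ℕ → ℝ) => ω i) (fun i => (measurable_pi_apply (i : ℕ)).aemeasurable)).1
    (h.precomp (Fin.val_injective (n := n)))
  refine h2.trans ?_
  congr 1
  ext1 i
  exact Measure.infinitePi_map_eval (fun _ : ℕ => μ) i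

lemma tendsto_absSumProb {θ : Param} (hθ : θ ∈ Theta) (hv : Var[id; law θ] ≠ 0) {a : ℝ}
    (ha : 0 ≤ a) :
    Tendsto (fun n => absSumProb n θ a) atTop (𝓝 (2 * Phi a - 1)) := by
  set Q := Measure.infinitePi fun _ : ℕ => law θ
  set u : ℝ → ℝ := fun x => (x - mean θ) / sigma θ with hu
  have hum : Measurable u := by fun_prop
  have hL : Integrable (fun x : ℝ => x) (law θ) := (memLp_law hθ).integrable one_le_two
  have hev (i : ℕ) : Q.map (fun ω => ω i) = law θ := Measure.infinitePi_map_eval _ i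
  have hX : ∀ {f : ℝ → ℝ}, Measurable f → ∫ ω, f (ω 0) ∂Q = ∫ x, f x ∂(law θ) := by
    intro f hf
    rw [← hev 0, integral_map (measurable_pi_apply 0).aemeasurable hf.aestronglyMeasurable]
  have hsig : sigma θ ^ 2 = Var[id; law θ] := Real.sq_sqrt (variance_nonneg _ _)
  have hclt := tendstoInDistribution_inv_sqrt_mul_sum (P := Q) (P' := gaussianReal 0 1)
    (Y := id) (X := fun i ω => u (ω i)) HasLaw.id ?_ ?_ ?_ ?_
  rotate_left
  · rw [hX hum, hu, integral_div, integral_sub hL (by fun_prop)]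
    simp [mean]
  · have : (fun ω : ℕ → ℝ => u (ω 0)) ^ 2 = fun ω => (fun x => u x ^ 2) (ω 0) := rfl
    rw [this, hX (hum.pow_const 2)]
    simp only [hu, div_pow]
    rw [integral_div, hsig, variance_eq_integral (by fun_prop)]
    rw [variance_eq_integral (by fun_prop)] at hv
    exact div_self hv
  · exact iIndepFun_infinitePi (X := fun _ => u) (fun _ => hum)
  · intro i
    have : IdentDistrib (fun ω : ℕ → ℝ => ω i) (fun ω => ω 0) Q Q :=
      ⟨(measurable_pi_apply i).aemeasurable, (measurable_pi_apply 0).aemeasurable,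
        by rw [hev, hev]⟩
    exact this.comp hum
  have hn : NullSingletonClass (gaussianReal 0 1) := nullSingletonClass_gaussianReal one_ne_zero
  -- Portmanteau: the two endpoints are null for the Gaussian limit.
  have h := ProbabilityMeasure.tendsto_measure_of_null_frontier_of_tendsto' hclt.tendsto
    (E := Set.Icc (-a) a) (by
      rw [frontier_Icc (by linarith)]
      simp only [ProbabilityMeasure.coe_mk, Measure.map_id]
      exact (Set.toFinite _).measure_zero _)
  simp only [ProbabilityMeasure.coe_mk, Measure.map_id] at h
  rw [← gaussianReal_real_Icc_neg_self ha]
  refine ((ENNReal.tendsto_toReal (measure_ne_top _ _)).comp h).congr fun n => ?_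
  have hrange (ω : ℕ → ℝ) : (√(n : ℝ))⁻¹ * ∑ k ∈ Finset.range n, u (ω k)
      = stdSum n θ (fun i : Fin n => ω i) := by
    rw [stdSum, Finset.sum_range, hu, ← Finset.sum_div, div_mul_eq_div_div, div_eq_inv_mul _ (√_)]
  have hms : MeasurableSet (stdSum n θ ⁻¹' Set.Icc (-a) a) :=
    measurable_stdSum n θ measurableSet_Icc
  simp only [Function.comp_apply, hrange, absSumProb]
  rw [← map_infinitePi_fin, measureReal_def]
  have hmm : Measurable fun (ω : ℕ → ℝ) (i : Fin n) => ω i := by fun_prop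
  change _ = ((Measure.map _ _) (stdSum n θ ⁻¹' Set.Icc (-a) a)).toReal
  rw [Measure.map_apply hmm hms]
  exact congrArg ENNReal.toReal
    (Measure.map_apply ((measurable_stdSum n θ).comp hmm) measurableSet_Icc)

theorem asympExactPointwise_ciKnown {α : ℝ} (hα : α ∈ Set.Ioo (0 : ℝ) 1) {σ : ℝ} (hσ : 0 < σ)
    {δ : ℕ → ℝ} (hδ0 : Tendsto δ atTop (𝓝 0)) :
    AsympExactPointwise law target (ThetaKnown σ) (ciKnown σ α δ) α := by
  obtain ⟨hα0, hα1⟩ := hα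
  intro θ hθ
  have hv : Var[id; law θ] ≠ 0 := by rw [hθ.2]; positivity
  have hlt : ∀ᶠ n in atTop, δ n < α / 2 := hδ0.eventually_lt_const (by linarith)
  have hτ : Tendsto (fun n => 1 - α / 2 + δ n) atTop (𝓝 (1 - α / 2)) := by
    simpa using hδ0.const_add (1 - α / 2)
  have lim {τ : ℝ} (h0 : 1 / 2 < τ) (h1 : τ < 1) :
      Tendsto (fun n => absSumProb n θ (gaussQuantile τ)) atTop (𝓝 (2 * τ - 1)) := by
    have := tendsto_absSumProb hθ.1 hv (gaussQuantile_nonneg h0 h1)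
    rwa [Phi_gaussQuantile (by linarith) h1] at this
  refine tendsto_order.2 ⟨fun l hl => ?_, fun r hr => ?_⟩
  -- A fixed order `τ` slightly below the limiting order `1 - α / 2`: `τ > 1 / 2` keeps its quantile
  -- nonnegative, and `τ > (l + 1) / 2` gives `l < 2 * τ - 1`.
  · obtain ⟨τ, h1, h2⟩ := exists_between
      (show max (1 / 2) ((l + 1) / 2) < 1 - α / 2 from max_lt (by linarith) (by linarith))
    rw [max_lt_iff] at h1
    filter_upwards [hlt, eventually_ge_atTop 1, hτ.eventually_const_lt h2,
      (lim h1.1 (by linarith)).eventually_const_lt (show l < 2 * τ - 1 by linarith)]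
      with n hn1 hn2 hn3 hn4
    rw [coverage_ciKnown hσ hθ hn2 hn1]
    exact hn4.trans_le (absSumProb_mono n θ
      (gaussQuantile_lt (by linarith) (by linarith) hn3).le)
  · obtain ⟨τ, h1, h2⟩ := exists_between
      (show 1 - α / 2 < min 1 ((r + 1) / 2) from lt_min (by linarith) (by linarith))
    rw [lt_min_iff] at h2
    filter_upwards [hlt, eventually_ge_atTop 1, hτ.eventually_lt_const h1,
      hτ.eventually_const_lt (show 0 < 1 - α / 2 by linarith),
      (lim (by linarith) h2.1).eventually_lt_const (show 2 * τ - 1 < r by linarith)]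
      with n hn1 hn2 hn3 hn4 hn5
    rw [coverage_ciKnown hσ hθ hn2 hn1]
    exact (absSumProb_mono n θ (gaussQuantile_lt hn4 h2.1 hn3).le).trans_lt hn5

/-! ### Uniform convergence -/

/-- An even, continuous correction of the normal c.d.f. does not affect the approximation of the
probability of a symmetric interval. -/
lemma abs_absSumProb_sub_le {n : ℕ} {θ : Param} {g : ℝ → ℝ} (hg : Continuous g)
    (hge : ∀ x, g (-x) = g x) {D : ℝ} (hD : ∀ x, |cdfSum n θ x - Phi x - g x| ≤ D)
    {a : ℝ} (ha : 0 ≤ a) : |absSumProb n θ a - (2 * Phi a - 1)| ≤ 2 * D := by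
  set P := Measure.pi fun _ : Fin n => law θ
  set ν := P.map (stdSum n θ)
  have : IsProbabilityMeasure ν :=
    Measure.isProbabilityMeasure_map (measurable_stdSum n θ).aemeasurable
  have hcdf (x : ℝ) : cdfSum n θ x = cdf ν x := by
    rw [cdf_eq_real, map_measureReal_apply (measurable_stdSum n θ) measurableSet_Iic]
    rfl
  have hsub : Set.Iio (-a) ⊆ Set.Iic a := fun x hx => (le_of_lt hx).trans (by linarith : -a ≤ a)
  have hprob : absSumProb n θ a = cdf ν a - ν.real (Set.Iio (-a)) := by
    rw [cdf_eq_real, ← measureReal_sdiff hsub measurableSet_Iio,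
      map_measureReal_apply (measurable_stdSum n θ)
        (measurableSet_Iic.diff measurableSet_Iio), absSumProb]
    congr 1
    ext ξ
    simp [and_comm]
  -- The interval is closed and `Sₙ` may have an atom at `-a`, so the left limit of the c.d.f.
  -- enters. The bound `D` passes to it because `Phi` and `g` are continuous.
  have hleft : Tendsto (cdf ν) (𝓝[<] (-a)) (𝓝 (ν.real (Set.Iio (-a)))) := by
    have h1 := (monotone_cdf ν).tendsto_leftLim (-a)
    have h2 : ν.real (Set.Iio (-a)) = Function.leftLim (cdf ν) (-a) := by
      have h3 := StieltjesFunction.measure_Iio (cdf ν) (tendsto_cdf_atBot ν) (-a)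
      rw [measure_cdf, sub_zero] at h3
      rw [measureReal_def, h3, ENNReal.toReal_ofReal]
      exact (cdf_nonneg ν (-a - 1)).trans ((monotone_cdf ν).le_leftLim (by linarith))
    rwa [h2]
  have hlim : |ν.real (Set.Iio (-a)) - Phi (-a) - g (-a)| ≤ D := by
    refine le_of_tendsto ((hleft.sub (continuous_Phi.continuousWithinAt)).sub
      hg.continuousWithinAt).abs (Eventually.of_forall fun x => ?_)
    rw [← hcdf]; exact hD x
  have ha' := hD a
  -- Both endpoint errors now involve the same `g a`, which drops out of their difference.
  rw [hge, Phi_neg] at hlim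
  rw [hcdf] at ha'
  rw [hprob]
  rw [abs_le] at *
  constructor <;> linarith

lemma abs_cdfSum_sub_Phi_le_one (n : ℕ) (θ : Param) (x : ℝ) : |cdfSum n θ x - Phi x| ≤ 1 := by
  have h1 := Phi_mem_Icc x
  have h2 : 0 ≤ cdfSum n θ x := measureReal_nonneg
  have h3 : cdfSum n θ x ≤ 1 := measureReal_le_one
  rw [abs_le]; constructor <;> linarith [h1.1, h1.2]

lemma abs_absSumProb_sub_le_min (n : ℕ) (θ : Param) {a : ℝ} (ha : 0 ≤ a) :
    |absSumProb n θ a - (2 * Phi a - 1)| ≤ 2 * min (DeltaE n θ) (DeltaB n θ) := by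
  have hB : ∀ x, |cdfSum n θ x - Phi x| ≤ DeltaB n θ :=
    le_ciSup (f := fun x => |cdfSum n θ x - Phi x|)
      ⟨1, by rintro _ ⟨x, rfl⟩; exact abs_cdfSum_sub_Phi_le_one n θ x⟩
  obtain ⟨C, hC⟩ := exists_bound_one_sub_sq_mul_phi
  have hE : ∀ x, |cdfSum n θ x - Phi x - lambda3 θ / (6 * √(n : ℝ)) * (1 - x ^ 2) * phi x|
      ≤ DeltaE n θ := by
    refine le_ciSup (f := fun x => |cdfSum n θ x - Phi x
      - lambda3 θ / (6 * √(n : ℝ)) * (1 - x ^ 2) * phi x|) ⟨1 + |lambda3 θ / (6 * √(n : ℝ))| * C, ?_⟩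
    rintro _ ⟨x, rfl⟩
    refine (abs_sub _ _).trans (add_le_add (abs_cdfSum_sub_Phi_le_one n θ x) ?_)
    rw [mul_assoc, abs_mul]
    exact mul_le_mul_of_nonneg_left (hC x) (abs_nonneg _)
  rcases min_choice (DeltaE n θ) (DeltaB n θ) with h | h <;> rw [h]
  · refine abs_absSumProb_sub_le
      (g := fun x => lambda3 θ / (6 * √(n : ℝ)) * (1 - x ^ 2) * phi x) ?_ ?_ hE ha
    · have : Continuous phi := by unfold phi gaussianPDFReal; fun_prop
      fun_prop
    · intro x
      simp [phi, gaussianPDFReal]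
  · exact abs_absSumProb_sub_le (g := fun _ => 0) continuous_const (fun _ => rfl)
      (by simpa using hB) ha

theorem asympExactUniformly_ciKnown {α : ℝ} (hα : α ∈ Set.Ioo (0 : ℝ) 1) {K σ : ℝ} (hσ : 0 < σ)
    {δ : ℕ → ℝ}
    (hδ : ∀ n : ℕ, 1 ≤ n →
      (⨆ θ ∈ ThetaEE K, ((min (DeltaE n θ) (DeltaB n θ) : ℝ) : EReal)) ≤ (δ n : EReal))
    (hδ0 : Tendsto δ atTop (𝓝 0)) :
    AsympExactUniformly law target (ThetaEEKnown K σ) (ciKnown σ α δ) α := by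
  obtain ⟨hα0, hα1⟩ := hα
  have hbound : Tendsto (fun n => 4 * |δ n|) atTop (𝓝 0) := by
    simpa using hδ0.abs.const_mul 4
  refine tendsto_of_tendsto_of_tendsto_of_le_of_le' tendsto_const_nhds hbound
    (Eventually.of_forall fun n => Real.iSup_nonneg fun _ => abs_nonneg _) ?_
  -- `δ n` can be negative: over an empty class the `EReal` supremum is `⊥`. The lower bound `-((1 -
  -- α) / 2)` keeps the quantile order above `1 / 2`.
  filter_upwards [hδ0.eventually_lt_const (show 0 < α / 2 by linarith), eventually_ge_atTop 1,
    hδ0.eventually_const_lt (show -((1 - α) / 2) < 0 by linarith)] with n hn1 hn2 hn3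
  refine Real.iSup_le (fun θ => ?_) (by positivity)
  obtain ⟨θ, hθ⟩ := θ
  have hmin : min (DeltaE n θ) (DeltaB n θ) ≤ δ n := EReal.coe_le_coe_iff.1
    ((le_iSup₂ (f := fun θ (_ : θ ∈ ThetaEE K) =>
      ((min (DeltaE n θ) (DeltaB n θ) : ℝ) : EReal)) θ hθ.1).trans (hδ n hn2))
  have hcov := abs_absSumProb_sub_le_min n θ
    (gaussQuantile_nonneg (τ := 1 - α / 2 + δ n) (by linarith) (by linarith))
  rw [Phi_gaussQuantile (by linarith) (by linarith)] at hcov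
  rw [coverage_ciKnown hσ ⟨hθ.1.1, hθ.2⟩ hn2 hn1]
  have h := le_abs_self (δ n)
  have h' := neg_abs_le (δ n)
  rw [abs_le] at hcov ⊢
  constructor <;> linarith [hcov.1, hcov.2]

end MeanCI

theorem mainTheorem12 (α : ℝ) (hα : α ∈ Set.Ioo (0 : ℝ) 1) (K : ℝ) (hK : 0 < K)
    (σ : ℝ) (hσ : 0 < σ) (δ : ℕ → ℝ)
    (hδ : ∀ n : ℕ, 1 ≤ n →
      (⨆ θ ∈ MeanCI.ThetaEE K, ((min (MeanCI.DeltaE n θ) (MeanCI.DeltaB n θ) : ℝ) : EReal))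
        ≤ (δ n : EReal))
    (hδ0 : Tendsto δ atTop (𝓝 0)) :
    MeanCI.AsympExactPointwise MeanCI.law MeanCI.target (MeanCI.ThetaKnown σ)
        (MeanCI.ciKnown σ α δ) α ∧
      MeanCI.AsympExactUniformly MeanCI.law MeanCI.target (MeanCI.ThetaEEKnown K σ)
        (MeanCI.ciKnown σ α δ) α := by
  exact ⟨MeanCI.asympExactPointwise_ciKnown hα hσ hδ0,
    MeanCI.asympExactUniformly_ciKnown hα hσ hδ hδ0⟩
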